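/- **Setting.** A representation $L$ of an adjacency list of a graph on the vertices $v_1,\dots,v_n$ gives every vertex $v_i$ ports $(i,1),\dots,(i,\deg(v_i))$ and a perfect matching of all ports; if $(i_1,j_1)$ and $(i_2,j_2)$ are matched, then the $j_1$-th neighbor of $v_{i_1}$ is $v_{i_2}$ and vice versa. It represents a simple graph $G$ if the list of each vertex contains each of its neighbors in $G$ exactly once. An algorithm may make, adaptively, neighbor queries (given $v$ and $1\le i<n$, the $i$-th neighbor of $v$ is returned, or $\bot$ if $i>\deg(v)$), degree queries (given $v$, $\deg(v)$ is returned) and random edge queries (an edge $\{u,v\}$ that is uniformly random, independently for each query, is returned). **Lemma.** Let $n_1,d_1,n_2,d_2$ be positive integer parameters such that $d_1$ and $n_2$ are even, $n_2\le d_1\le 2d_2$ and $d_1+2d_2<n_1$. Let $n=n_1+n_2$, and define two families of simple graphs on $n$ vertices: - $\mathcal F_1$: all graphs with $n_1$ vertices of degree $d_1$ and the remaining $n_2$ vertices isolated; - $\mathcal F_2$: all graphs with $n_1$ vertices of degree $d_1$ and the remaining $n_2$ vertices of degree $d_2$. Let $r=\frac{(d_1+d_2)n_2}{d_1n_1}$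 and $q=o(1/r)$; here the parameters and the natural number $q$ may vary along an arbitrary family (index set with a filter, for example a sequence), and the asymptotics refer to it. Then for each member of the family there is a probability distribution $\mathcal D$ on representations of graphs from $\mathcal F_1\cup\mathcal F_2$ such that, eventually along the family (for a sequence: for all sufficiently large indices), the following holds. For every deterministic algorithm $\mathcal A$ that makes at most $q$ neighbor, degree and random edge queries in total on every representation in the support of $\mathcal D$, the probability, over a representation drawn from $\mathcal D$ and over the answers to the random edge queries, that $\mathcal A$ correctly outputs whether the representation is of a graph from $\mathcal F_1$ or from $\mathcal F_2$ is strictly less than $2/3$. -/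

import Mathlib

open Filter Asymptotics

noncomputable section

namespace StarLower

/-- A representation of an adjacency list on `n` vertices: vertex `v` has `deg v` ports, and `mate`
is a perfect matching of the ports (a fixed-point-free involution). Ports are numbered from `0`, so
the port `⟨v, j⟩` is the one with number `j + 1`. Parallel edges and self-loops are not excluded. -/
structure Representation (n : ℕ) where
  deg : Fin n → ℕ
  mate : (Σ v : Fin n, Fin (deg v)) → (Σ v : Fin n, Fin (deg v))
  mate_mate : ∀ p, mate (mate p) = p
  mate_ne : ∀ p, mate p ≠ p

namespace Representation

variable {n : ℕ}

/-- The ports of the representation. -/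
abbrev Port (L : Representation n) : Type := Σ v : Fin n, Fin (L.deg v)

/-- The neighbor of `v` listed at the port with number `j + 1`. -/
def nbr (L : Representation n) (v : Fin n) (j : Fin (L.deg v)) : Fin n :=
  (L.mate ⟨v, j⟩).1

/-- `L` represents the simple graph `G`: for every vertex `v`, the list of `v` enumerates the
neighbors of `v` in `G`, each exactly once. -/
def Represents (L : Representation n) (G : SimpleGraph (Fin n)) : Prop :=
  ∀ v, Function.Injective (L.nbr v) ∧ Set.range (L.nbr v) = G.neighborSet v

/-- The edges of the representation: the matched pairs of ports. -/
def edges (L : Representation n) : Finset (Sym2 L.Port) :=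
  Finset.univ.image fun p => s(p, L.mate p)

end Representation

/-- The two families, which are also the two possible outputs of an algorithm. -/
inductive Family
  | first
  | second

/-- The graphs on `n₁ + n₂` vertices in which some `n₁` vertices have degree `d` and the
remaining `n₂` vertices have degree `d'`. -/
def twoDegreeGraphs (n₁ d n₂ d' : ℕ) : Set (SimpleGraph (Fin (n₁ + n₂))) :=
  {G | ∃ S : Finset (Fin (n₁ + n₂)), S.card = n₁ ∧
    (∀ v ∈ S, (G.neighborSet v).ncard = d) ∧ ∀ v ∉ S, (G.neighborSet v).ncard = d'}

/-- The graphs of the two families: `n₁` vertices of degree `d₁`, and the other `n₂` vertices are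
isolated in the first family and of degree `d₂` in the second. -/
def Family.graphs (n₁ d₁ n₂ d₂ : ℕ) : Family → Set (SimpleGraph (Fin (n₁ + n₂)))
  | .first => twoDegreeGraphs n₁ d₁ n₂ 0
  | .second => twoDegreeGraphs n₁ d₁ n₂ d₂

/-- The representations of the graphs of a family. -/
def Family.reps (n₁ d₁ n₂ d₂ : ℕ) (F : Family) : Set (Representation (n₁ + n₂)) :=
  {L | ∃ G ∈ F.graphs n₁ d₁ n₂ d₂, L.Represents G}

/-- The queries to a graph on `n` vertices. The query `neighbor v i` asks for the neighbor of `v`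
with index `i + 1`, so that the index ranges over `1, …, n - 1`. -/
inductive Query (n : ℕ)
  | neighbor (v : Fin n) (i : Fin (n - 1))
  | degree (v : Fin n)
  | randomEdge

/-- The type of the answers to a query; `none` stands for `⊥`. -/
def Query.Answer {n : ℕ} : Query n → Type
  | .neighbor _ _ => Option (Fin n)
  | .degree _ => ℕ
  | .randomEdge => Option (Sym2 (Fin n))

/-- The distribution of the answer of the oracle of `L` to a query. A random edge query returns the
two end vertices of a uniformly random edge (and `⊥` if there is no edge at all). -/
def Representation.oracle {n : ℕ} (L : Representation n) : (Q : Query n) → PMF Q.Answer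
  | .neighbor v i =>
      (PMF.pure (if h : (i : ℕ) < L.deg v then some (L.nbr v ⟨i, h⟩) else none) :
        PMF (Option (Fin n)))
  | .degree v => (PMF.pure (L.deg v) : PMF ℕ)
  | .randomEdge =>
      open Classical in
      (if h : L.edges.Nonempty then
        (PMF.uniformOfFinset L.edges h).map fun e => some (e.map Sigma.fst)
      else PMF.pure none : PMF (Option (Sym2 (Fin n))))

/-- A deterministic adaptive query algorithm on graphs with `n` vertices, as a decision tree:
it either stops with an output or asks a query and continues according to the answer. -/
inductive Algorithm (n : ℕ) : Type
  | output (F : Family)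
  | ask (Q : Query n) (next : Q.Answer → Algorithm n)

namespace Algorithm

variable {n : ℕ}

/-- The distribution of the output of the algorithm on `L`. The only randomness is that of the
oracle, and different queries are answered independently. -/
def run (L : Representation n) : Algorithm n → PMF Family
  | .output F => PMF.pure F
  | .ask Q next => (L.oracle Q).bind fun a => run L (next a)

/-- On `L` the algorithm makes at most the given number of queries in total, whatever answers
the oracle of `L` gives. -/
def MakesAtMost (L : Representation n) : Algorithm n → ℕ → Prop
  | .output _, _ => True
  | .ask _ _, 0 => False
  | .ask Q next, q + 1 => ∀ a ∈ (L.oracle Q).support, MakesAtMost L (next a) q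

end Algorithm

/-- The probability, over a representation `L` drawn from `D` and the random answers of the oracle
of `L`, that the output of the algorithm is a family to which the graph of `L` belongs. -/
def successProb {n₁ n₂ : ℕ} (d₁ d₂ : ℕ) (D : PMF (Representation (n₁ + n₂)))
    (A : Algorithm (n₁ + n₂)) : ENNReal :=
  (D.bind fun L => (A.run L).map fun F => (L, F)).toOuterMeasure
    {x | x.1 ∈ x.2.reps n₁ d₁ n₂ d₂}

end StarLower

end

/-!
A single oracle, fixed in advance and the same for both families, is compared with the random
representations of each family. It describes the circulant graph on all `n = n₁ + n₂` vertices with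
the steps `±1, …, ±h`, where `d₁ = 2 * h`; in particular every vertex appears to have degree `d₁`.

Write `n₂ = 2 * k`. A graph of the first family is the circulant graph on `n₁` vertices together
with `2 * k` isolated vertices. It arises from the large circulant graph by cutting out an interval
of `2 * k` vertices and joining the vertices on either side of the gap, which affects only few edges
per step. A graph of the second family arises from that of the first as follows: for each of `k` of
the `h` steps, `d₂` edges of this step are cut and their halves are attached to two of the new
vertices (`hardGraph`, where the first family is the case of no cut edges). The vertices are shifted
cyclically at random, and so is the choice of the steps (`shiftedGraph`). Hence each fixed edge of
the large circulant graph survives except with probability `O(r)` (`card_not_adj_le`). The lists are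
ordered so that each surviving edge keeps its place in the list of each old end vertex
(`exists_represents_agreeing`). So for each fixed query the answer has distance `O(r)` on average
from that of the fixed oracle; a random edge is treated as the edge at a uniformly random port
(`tsum_answerDistance_le`).

As the fixed oracle does not depend on the random choices, induction on the decision tree shows that
the output after `q` queries changes by at most `q * O(r)` in distribution
(`Algorithm.expected_runWith_truncate_le`); no conditioning on earlier answers is needed. Along the
answers of the fixed oracle the algorithm may ask more than `q` queries, and it is truncated for
this reason. With the fair choice between the families, the probability of a correct output is at
most `1 / 2 + 2 * r * q`.
-/

noncomputable section

namespace StarLower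

open scoped ENNReal

/-! ### Decision trees run against an oracle -/

namespace Algorithm

variable {n : ℕ}

/-- The distribution of the output of the algorithm when its queries are answered by `O`, which need
not be the oracle of a representation. -/
def runWith (O : (Q : Query n) → PMF Q.Answer) : Algorithm n → PMF Family
  | .output F => PMF.pure F
  | .ask Q next => (O Q).bind fun a => runWith O (next a)

theorem run_eq_runWith (L : Representation n) (A : Algorithm n) :
    A.run L = A.runWith L.oracle := by
  induction A with
  | output F => rfl
  | ask Q next ih => simp only [run, runWith, ih]

/-- The algorithm that stops, with an arbitrary output, instead of asking more than `q` queries. -/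
def truncate : Algorithm n → ℕ → Algorithm n
  | .output F, _ => .output F
  | .ask _ _, 0 => .output .first
  | .ask Q next, q + 1 => .ask Q fun a => truncate (next a) q

theorem run_truncate {L : Representation n} {A : Algorithm n} {q : ℕ}
    (h : A.MakesAtMost L q) : (A.truncate q).run L = A.run L := by
  induction A generalizing q with
  | output F => cases q <;> rfl
  | ask Q next ih =>
    cases q with
    | zero => exact h.elim
    | succ q =>
      ext F
      simp only [truncate, run, PMF.bind_apply]
      refine tsum_congr fun a => ?_
      by_cases ha : a ∈ (L.oracle Q).support
      · rw [ih a (h a ha)]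
      · rw [(PMF.apply_eq_zero_iff _ _).2 ha, zero_mul, zero_mul]

/-- If, for every fixed query, a random oracle is on average `ε`-close to a fixed oracle `O₀`, then
`q` adaptive queries distinguish the two with advantage at most `q * ε`. Averaging over `ω` is done
for each node of the tree separately; this is possible because `O₀` does not depend on `ω`. -/
theorem expected_runWith_truncate_le {Ω : Type*} (μ : PMF Ω)
    (O : Ω → (Q : Query n) → PMF Q.Answer) (O₀ : (Q : Query n) → PMF Q.Answer)
    (δ : Ω → Query n → ℝ≥0∞) (ε : ℝ≥0∞)
    (hδ : ∀ ω Q (g : Q.Answer → ℝ≥0∞), (∀ a, g a ≤ 1) →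
      ∑' a, O ω Q a * g a ≤ ∑' a, O₀ Q a * g a + δ ω Q)
    (hε : ∀ Q, ∑' ω, μ ω * δ ω Q ≤ ε) (F : Family) (A : Algorithm n) (q : ℕ) :
    ∑' ω, μ ω * (A.truncate q).runWith (O ω) F ≤ (A.truncate q).runWith O₀ F + q * ε := by
  have hconst : ∀ G : Family, ∑' ω, μ ω * (PMF.pure G : PMF Family) F =
      (PMF.pure G : PMF Family) F := fun G => by
    rw [ENNReal.tsum_mul_right, PMF.tsum_coe, one_mul]
  induction A generalizing q with
  | output G =>
    simp only [truncate, runWith, hconst]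
    exact le_self_add
  | ask Q next ih =>
    cases q with
    | zero =>
      simp only [truncate, runWith, hconst]
      exact le_self_add
    | succ q =>
      simp only [truncate, runWith, PMF.bind_apply]
      calc ∑' ω, μ ω * ∑' a, O ω Q a * ((next a).truncate q).runWith (O ω) F
          ≤ ∑' ω, μ ω * (∑' a, O₀ Q a * ((next a).truncate q).runWith (O ω) F + δ ω Q) := by
            gcongr with ω
            exact hδ ω Q _ fun a => PMF.coe_le_one _ _
        _ = ∑' a, O₀ Q a * ∑' ω, μ ω * ((next a).truncate q).runWith (O ω) F
              + ∑' ω, μ ω * δ ω Q := by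
            simp only [mul_add, ENNReal.tsum_add, ← ENNReal.tsum_mul_left]
            rw [ENNReal.tsum_comm]
            simp only [mul_left_comm]
        _ ≤ ∑' a, O₀ Q a * (((next a).truncate q).runWith O₀ F + q * ε) + ε := by
            gcongr with a
            · exact ih a q
            · exact hε Q
        _ = ∑' a, O₀ Q a * ((next a).truncate q).runWith O₀ F + ((q + 1 : ℕ) : ℝ≥0∞) * ε := by
            simp only [mul_add, ENNReal.tsum_add, ENNReal.tsum_mul_right, PMF.tsum_coe]
            push_cast
            ring

end Algorithm

/-! ### Random edges as random ports -/

theorem tsum_map_mul {α β : Type*} (p : PMF α) (f : α → β) (g : β → ℝ≥0∞) :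
    ∑' b, p.map f b * g b = ∑' a, p a * g (f a) := by
  classical
  simp only [PMF.map_apply, ← ENNReal.tsum_mul_right]
  rw [ENNReal.tsum_comm]
  refine tsum_congr fun a => ?_
  rw [tsum_eq_single (f a) fun b hb => by simp [hb]]
  simp

namespace Representation

variable {n : ℕ} (L : Representation n)

open Classical in
theorem card_filter_edge_eq {e : Sym2 L.Port} (he : e ∈ L.edges) :
    (Finset.univ.filter fun p => s(p, L.mate p) = e).card = 2 := by
  obtain ⟨p, -, rfl⟩ := Finset.mem_image.1 he
  rw [Finset.card_eq_two]
  refine ⟨p, L.mate p, (L.mate_ne p).symm, ?_⟩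
  ext p'
  simp only [Finset.mem_filter, Finset.mem_univ, true_and, Finset.mem_insert,
    Finset.mem_singleton, Sym2.eq_iff]
  constructor
  · rintro (h | h)
    · exact .inl h.1
    · exact .inr h.1
  · rintro (rfl | rfl)
    · exact .inl ⟨rfl, rfl⟩
    · exact .inr ⟨rfl, L.mate_mate p⟩

/-- Each edge consists of two ports, so the edge at a uniformly random port is uniform. -/
theorem tsum_oracle_randomEdge [Nonempty L.Port] (g : Option (Sym2 (Fin n)) → ℝ≥0∞) :
    ∑' a : Option (Sym2 (Fin n)), (L.oracle .randomEdge : PMF (Option (Sym2 (Fin n)))) a * g a =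
      (∑ p : L.Port, g (some s(p.1, L.nbr p.1 p.2))) / Fintype.card L.Port := by
  classical
  have hne : L.edges.Nonempty := by
    obtain ⟨p⟩ := ‹Nonempty L.Port›
    exact ⟨_, Finset.mem_image_of_mem _ (Finset.mem_univ p)⟩
  have hmaps : ∀ p ∈ (Finset.univ : Finset L.Port), s(p, L.mate p) ∈ L.edges := fun p hp =>
    Finset.mem_image_of_mem _ hp
  have hcard : Fintype.card L.Port = L.edges.card * 2 := by
    rw [← Finset.card_univ, Finset.card_eq_sum_card_fiberwise hmaps,
      Finset.sum_congr rfl fun e he => L.card_filter_edge_eq he, Finset.sum_const, smul_eq_mul]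
  have hsum : ∑ p : L.Port, g (some s(p.1, L.nbr p.1 p.2)) =
      (∑ e ∈ L.edges, g (some (e.map Sigma.fst))) * 2 := by
    rw [← Finset.sum_fiberwise_of_maps_to hmaps, Finset.sum_mul]
    refine Finset.sum_congr rfl fun e he => ?_
    have : ∀ p ∈ Finset.univ.filter (fun p => s(p, L.mate p) = e),
        g (some s(p.1, L.nbr p.1 p.2)) = g (some (e.map Sigma.fst)) := by
      intro p hp
      rw [← (Finset.mem_filter.1 hp).2]
      rfl
    rw [Finset.sum_congr rfl this, Finset.sum_const, L.card_filter_edge_eq he, nsmul_eq_mul,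
      mul_comm]
    norm_num
  rw [hsum, hcard, Nat.cast_mul, Nat.cast_ofNat,
    ENNReal.mul_div_mul_right _ _ (by norm_num) (by norm_num)]
  have ho : (L.oracle .randomEdge : PMF (Option (Sym2 (Fin n)))) =
      (PMF.uniformOfFinset L.edges hne).map fun e => some (e.map Sigma.fst) := dif_pos hne
  refine (congrArg (fun p : PMF (Option (Sym2 (Fin n))) => ∑' a, p a * g a) ho).trans ?_
  rw [tsum_map_mul, tsum_eq_sum (s := L.edges) fun e he => by
    rw [PMF.uniformOfFinset_apply_of_notMem hne he, zero_mul]]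
  rw [div_eq_mul_inv, Finset.sum_mul]
  refine Finset.sum_congr rfl fun e he => ?_
  rw [PMF.uniformOfFinset_apply_of_mem hne he, mul_comm]

end Representation

/-! ### Comparison with a fixed reference oracle -/

/-- The averages of two functions are close if the functions agree, along an injection, on all but
few points of one domain, and the other domain is not much larger. -/
theorem sum_div_card_le {α β : Type*} [Fintype α] [Fintype β] [Nonempty α] [Nonempty β]
    (a : α → ℝ≥0∞) (b : β → ℝ≥0∞) (ha : ∀ x, a x ≤ 1) (S : Finset β) (i : β → α)
    (hi : Set.InjOn i S) (hab : ∀ x ∈ S, a (i x) = b x) {c B : ℕ}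
    (hc : Fintype.card β = S.card + c) (hB : Fintype.card α ≤ Fintype.card β + B) :
    (∑ x, a x) / Fintype.card α ≤ (∑ y, b y) / Fintype.card β +
      ((c : ℝ≥0∞) + B) / Fintype.card β := by
  classical
  set T : ℝ≥0∞ := ∑ y ∈ S, b y with hT
  have hTS : T ≤ S.card := by
    calc T ≤ ∑ y ∈ S, 1 := Finset.sum_le_sum fun y hy => hab y hy ▸ ha _
      _ = S.card := by simp
  have hcard : (S.image i).card = S.card := Finset.card_image_of_injOn hi
  obtain ⟨m, hm⟩ : ∃ m, Fintype.card α = S.card + m :=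
    Nat.exists_eq_add_of_le (hcard ▸ Finset.card_le_univ _)
  have hcompl : (S.image i)ᶜ.card = m := by rw [Finset.card_compl, hcard]; omega
  have h1 : ∑ x, a x ≤ T + m := by
    rw [← Finset.sum_add_sum_compl (S.image i), Finset.sum_image hi, Finset.sum_congr rfl hab]
    gcongr
    calc ∑ x ∈ (S.image i)ᶜ, a x ≤ ∑ x ∈ (S.image i)ᶜ, 1 := Finset.sum_le_sum fun x _ => ha x
      _ = m := by simp [hcompl]
  have h2 : T ≤ ∑ y, b y := Finset.sum_le_sum_of_subset (Finset.subset_univ S)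
  have hα : 0 < S.card + m := hm ▸ Fintype.card_pos
  have hβ : 0 < S.card + c := hc ▸ Fintype.card_pos
  have hmB : m ≤ c + B := by omega
  rw [← ENNReal.add_div]
  refine (ENNReal.div_le_div_right h1 _).trans
    (le_trans ?_ (ENNReal.div_le_div_right (add_le_add_left h2 _) _))
  rw [hm, hc]
  clear_value T
  generalize S.card = U at *
  lift T to NNReal using ne_top_of_le_ne_top (ENNReal.natCast_ne_top U) hTS
  have hTU : (T : ℝ) ≤ U := by exact_mod_cast hTS
  have hα' : (0 : ℝ) < U + m := by exact_mod_cast hα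
  have hβ' : (0 : ℝ) < U + c := by exact_mod_cast hβ
  have hmB' : (m : ℝ) ≤ c + B := by exact_mod_cast hmB
  have key : ((T : ℝ) + m) / (U + m) ≤ (T + (c + B)) / (U + c) := by
    rw [div_le_div_iff₀ hα' hβ']
    have hT0 : (0 : ℝ) ≤ T := T.2
    have hm0 : (0 : ℝ) ≤ m := m.cast_nonneg
    have hB0 : (0 : ℝ) ≤ B := B.cast_nonneg
    nlinarith [mul_nonneg (sub_nonneg.2 hmB') (sub_nonneg.2 hTU), mul_nonneg hB0 hT0,
      mul_nonneg hB0 hm0]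
  have key' : (T + m) / (U + m) ≤ (T + (c + B)) / ((U : NNReal) + c) := by
    rw [← NNReal.coe_le_coe]
    push_cast
    exact key
  have e1 : ((U : NNReal) + m) ≠ 0 := by exact_mod_cast hα.ne'
  have e2 : ((U : NNReal) + c) ≠ 0 := by exact_mod_cast hβ.ne'
  have := ENNReal.coe_le_coe.2 key'
  rw [ENNReal.coe_div e1, ENNReal.coe_div e2] at this
  push_cast at this ⊢
  exact this

variable {n d : ℕ}

/-- The representation answers the query to the port with number `j + 1` of `v`, and the degree
query to `v`, as the lists `f`, all of length `d`, prescribe. -/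
def Representation.Agrees (L : Representation n) (f : Fin n → Fin d → Fin n) (v : Fin n)
    (j : Fin d) : Prop :=
  L.deg v = d ∧ ∃ h : (j : ℕ) < L.deg v, L.nbr v ⟨j, h⟩ = f v j

/-- The oracle of the system of lists `f`, all of length `d`. A random edge is the edge at a
uniformly random list entry; `f` need not come from a graph. -/
def referenceOracle [NeZero n] [NeZero d] (f : Fin n → Fin d → Fin n) :
    (Q : Query n) → PMF Q.Answer
  | .neighbor v i =>
      (PMF.pure (if h : (i : ℕ) < d then some (f v ⟨i, h⟩) else none) : PMF (Option (Fin n)))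
  | .degree _ => (PMF.pure d : PMF ℕ)
  | .randomEdge =>
      ((PMF.uniformOfFintype (Fin n × Fin d)).map fun p => some s(p.1, f p.1 p.2) :
        PMF (Option (Sym2 (Fin n))))

open Classical in
/-- A bound for the distance between the answers of `L` and of the reference oracle to a query,
where `B` bounds the number of ports of `L` in excess of `n * d`. -/
def answerDistance [NeZero n] [NeZero d] (f : Fin n → Fin d → Fin n) (B : ℕ)
    (L : Representation n) : Query n → ℝ≥0∞
  | .randomEdge =>
      ((∑ p : Fin n × Fin d, if L.Agrees f p.1 p.2 then 0 else 1) + B) / (n * d : ℕ)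
  | Q => if L.oracle Q = referenceOracle f Q then 0 else 1

theorem tsum_le_of_ite {α : Type*} (p p₀ : PMF α) [Decidable (p = p₀)] (g : α → ℝ≥0∞)
    (hg : ∀ a, g a ≤ 1) :
    ∑' a, p a * g a ≤ ∑' a, p₀ a * g a + if p = p₀ then 0 else 1 := by
  split_ifs with h
  · rw [h, add_zero]
  · calc ∑' a, p a * g a ≤ ∑' a, p a * 1 := by gcongr with a; exact hg a
      _ = 1 := by simp [PMF.tsum_coe]
      _ ≤ _ := le_add_self

theorem tsum_oracle_le [NeZero n] [NeZero d] (f : Fin n → Fin d → Fin n) (B : ℕ)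
    (L : Representation n) [Nonempty L.Port] (hB : Fintype.card L.Port ≤ n * d + B)
    (Q : Query n) (g : Q.Answer → ℝ≥0∞) (hg : ∀ a, g a ≤ 1) :
    ∑' a, L.oracle Q a * g a ≤
      ∑' a, referenceOracle f Q a * g a + answerDistance f B L Q := by
  classical
  cases Q with
  | neighbor v i =>
    exact (tsum_le_of_ite _ _ g hg).trans_eq (by congr)
  | degree v =>
    exact (tsum_le_of_ite _ _ g hg).trans_eq (by congr)
  | randomEdge =>
    have hcard : Fintype.card (Fin n × Fin d) = n * d := by simp
    have href : ∑' a : Option (Sym2 (Fin n)),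
        (referenceOracle f .randomEdge : PMF (Option (Sym2 (Fin n)))) a * g a =
          (∑ p : Fin n × Fin d, g (some s(p.1, f p.1 p.2))) / Fintype.card (Fin n × Fin d) := by
      refine (tsum_map_mul (PMF.uniformOfFintype (Fin n × Fin d))
        (fun p => some s(p.1, f p.1 p.2)) g).trans ?_
      rw [tsum_fintype, div_eq_mul_inv, Finset.sum_mul]
      exact Finset.sum_congr rfl fun p _ => by rw [PMF.uniformOfFintype_apply, mul_comm]
    refine (L.tsum_oracle_randomEdge g).trans_le (le_trans ?_ (add_le_add_left href.ge _))
    let S := Finset.univ.filter fun p : Fin n × Fin d => L.Agrees f p.1 p.2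
    let i : Fin n × Fin d → L.Port := fun p =>
      if h : (p.2 : ℕ) < L.deg p.1 then ⟨p.1, p.2, h⟩ else Classical.arbitrary _
    have hi : ∀ p ∈ S, ∃ h : (p.2 : ℕ) < L.deg p.1, i p = ⟨p.1, p.2, h⟩ ∧
        L.nbr p.1 ⟨p.2, h⟩ = f p.1 p.2 := by
      intro p hp
      obtain ⟨-, h, h'⟩ := (Finset.mem_filter.1 hp).2
      exact ⟨h, dif_pos h, h'⟩
    have hmain := sum_div_card_le (fun p : L.Port => g (some s(p.1, L.nbr p.1 p.2)))
      (fun p : Fin n × Fin d => g (some s(p.1, f p.1 p.2))) (fun _ => hg _) S i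
      (c := (Finset.univ.filter fun p : Fin n × Fin d => ¬ L.Agrees f p.1 p.2).card) (B := B)
      (by
        intro p hp p' hp' H
        obtain ⟨h, h1, -⟩ := hi p hp
        obtain ⟨h', h1', -⟩ := hi p' hp'
        rw [h1, h1'] at H
        obtain ⟨v, j⟩ := p
        obtain ⟨v', j'⟩ := p'
        obtain rfl : v = v' := congrArg Sigma.fst H
        have := Fin.ext_iff.1 (eq_of_heq (Sigma.mk.inj H).2)
        exact Prod.ext rfl (Fin.ext this))
      (by
        intro p hp
        obtain ⟨h, h1, h2⟩ := hi p hp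
        rw [← h2]
        exact congrArg (fun x : L.Port => g (some s(x.1, L.nbr x.1 x.2))) h1)
      (by
        rw [← Finset.card_univ, ← Finset.card_filter_add_card_filter_not (s := Finset.univ)
          (fun p : Fin n × Fin d => L.Agrees f p.1 p.2)])
      (by rw [hcard]; exact hB)
    refine hmain.trans_eq ?_
    congr 1
    simp only [answerDistance, hcard]
    congr 2
    rw [Finset.card_filter]
    push_cast
    exact Finset.sum_congr rfl fun p _ => by split_ifs <;> simp_all

/-- The expected distance to the reference oracle is small for every fixed query as soon as each
fixed port is unlikely to be affected. -/
theorem tsum_answerDistance_le [NeZero n] [NeZero d] {Ω : Type*} (μ : PMF Ω)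
    (f : Fin n → Fin d → Fin n) (B : ℕ) (L : Ω → Representation n) (ε : ℝ≥0∞)
    (hε : ∀ v j, μ.toOuterMeasure {ω | ¬ (L ω).Agrees f v j} ≤ ε) (Q : Query n) :
    ∑' ω, μ ω * answerDistance f B (L ω) Q ≤ ε + B / (n * d : ℕ) := by
  classical
  have hε' : ∀ v j, ∑' ω, μ ω * (if (L ω).Agrees f v j then 0 else 1) ≤ ε := fun v j => by
    refine le_of_eq_of_le ?_ (hε v j)
    rw [PMF.toOuterMeasure_apply]
    refine tsum_congr fun ω => ?_
    by_cases h : (L ω).Agrees f v j <;> simp [h]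
  have hdet : ∀ (Q : Query n) v j,
      (∀ ω, (L ω).Agrees f v j → (L ω).oracle Q = referenceOracle f Q) →
      ∑' ω, μ ω * (if (L ω).oracle Q = referenceOracle f Q then 0 else 1 : ℝ≥0∞) ≤
        ε + B / (n * d : ℕ) := by
    intro Q v j H
    refine le_trans (le_trans ?_ (hε' v j)) le_self_add
    gcongr with ω
    by_cases h : (L ω).Agrees f v j
    · rw [if_pos (H ω h)]
      exact zero_le
    · rw [if_neg h]
      split_ifs
      · exact zero_le
      · exact le_rfl
  cases Q with
  | neighbor v i =>
    by_cases hi : (i : ℕ) < d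
    · refine hdet (.neighbor v i) v ⟨i, hi⟩ fun ω ⟨_, h, h'⟩ => ?_
      simp only [Representation.oracle, referenceOracle]
      rw [dif_pos h, dif_pos hi, ← h']
    · refine hdet (.neighbor v i) v 0 fun ω ⟨h, _⟩ => ?_
      simp only [Representation.oracle, referenceOracle]
      rw [dif_neg (h ▸ hi), dif_neg hi]
  | degree v =>
    refine hdet (.degree v) v 0 fun ω ⟨h, _⟩ => ?_
    exact congrArg (fun m => (PMF.pure m : PMF ℕ)) h
  | randomEdge =>
    have hnd : ((n * d : ℕ) : ℝ≥0∞) ≠ 0 := by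
      exact_mod_cast mul_ne_zero (NeZero.ne n) (NeZero.ne d)
    calc ∑' ω, μ ω * answerDistance f B (L ω) .randomEdge
        = (∑ p : Fin n × Fin d, ∑' ω, μ ω * (if (L ω).Agrees f p.1 p.2 then 0 else 1) +
            B) / (n * d : ℕ) := by
          simp only [answerDistance, div_eq_mul_inv, ← mul_assoc, ENNReal.tsum_mul_right]
          congr 1
          simp only [mul_add, ENNReal.tsum_add, ENNReal.tsum_mul_right, PMF.tsum_coe, one_mul,
            Finset.mul_sum]
          rw [Summable.tsum_finsetSum fun _ _ => ENNReal.summable]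
      _ ≤ (∑ _p : Fin n × Fin d, ε + B) / (n * d : ℕ) := by
          gcongr with p
          exact hε' p.1 p.2
      _ = ε + B / (n * d : ℕ) := by
          rw [ENNReal.add_div, Finset.sum_const, Finset.card_univ, Fintype.card_prod,
            Fintype.card_fin, Fintype.card_fin, nsmul_eq_mul, mul_comm,
            ENNReal.mul_div_cancel_right hnd (ENNReal.natCast_ne_top _)]

/-- If every port of a random representation is likely to agree with the lists `f`, then few queries
cannot distinguish it from these lists. -/
theorem expected_run_le [NeZero n] [NeZero d] {Ω : Type*} (μ : PMF Ω)
    (f : Fin n → Fin d → Fin n) (B : ℕ) (L : Ω → Representation n) (ε : ℝ≥0∞)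
    (hL : ∀ ω, Nonempty (L ω).Port) (hB : ∀ ω, Fintype.card (L ω).Port ≤ n * d + B)
    (hε : ∀ v j, μ.toOuterMeasure {ω | ¬ (L ω).Agrees f v j} ≤ ε)
    (F : Family) (A : Algorithm n) (q : ℕ) :
    ∑' ω, μ ω * (A.truncate q).run (L ω) F ≤
      (A.truncate q).runWith (referenceOracle f) F + q * (ε + B / (n * d : ℕ)) := by
  simp only [Algorithm.run_eq_runWith]
  exact Algorithm.expected_runWith_truncate_le μ (fun ω => (L ω).oracle) (referenceOracle f)
    (fun ω => answerDistance f B (L ω)) _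
    (fun ω Q g hg => haveI := hL ω; tsum_oracle_le f B (L ω) (hB ω) Q g hg)
    (tsum_answerDistance_le μ f B L ε hε) F A q

/-! ### Representations of a graph with prescribed lists -/

/-- Every graph has a representation that agrees with a given system `f` of lists of length `d`
wherever possible: at a vertex of degree `d`, each entry of `f v` that is a neighbor of `v` keeps
its place. -/
theorem exists_represents_agreeing {n d : ℕ} (G : SimpleGraph (Fin n))
    (f : Fin n → Fin d → Fin n) (hf : ∀ v, Function.Injective (f v)) :
    ∃ L : Representation n, L.Represents G ∧ (∀ v, L.deg v = (G.neighborSet v).ncard) ∧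
      ∀ v (j : Fin d), L.deg v = d → G.Adj v (f v j) →
        ∃ h : (j : ℕ) < L.deg v, L.nbr v ⟨j, h⟩ = f v j := by
  classical
  have key : ∀ v, ∃ e : Fin (G.neighborSet v).ncard ≃ G.neighborSet v,
      ∀ j : Fin d, (G.neighborSet v).ncard = d → G.Adj v (f v j) →
        ∃ h : (j : ℕ) < (G.neighborSet v).ncard, (e ⟨j, h⟩ : Fin n) = f v j := by
    intro v
    by_cases hd : (G.neighborSet v).ncard = d
    · have hcard : Fintype.card (Fin d) = (G.neighborSet v).toFinset.card := by
        rw [Fintype.card_fin, ← Set.ncard_eq_toFinset_card', hd]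
      obtain ⟨g, hg⟩ := Finset.exists_equiv_extend_of_card_eq hcard
        (s := Finset.univ.filter fun j => G.Adj v (f v j)) (f := f v)
        (by
          intro x hx
          obtain ⟨j, hj, rfl⟩ := Finset.mem_image.1 hx
          simpa using hj)
        (hf v).injOn
      refine ⟨(finCongr hd).trans (g.trans (Equiv.subtypeEquivRight fun x => by simp)),
        fun j _ hj => ⟨hd.symm ▸ j.2, ?_⟩⟩
      exact hg j (by simpa using hj)
    · refine ⟨Fintype.equivOfCardEq ?_, fun j h => absurd h hd⟩
      rw [Fintype.card_fin, ← Nat.card_coe_set_eq, Nat.card_eq_fintype_card]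
  choose e he using key
  let flip : (Σ v, G.neighborSet v) → Σ v, G.neighborSet v := fun p =>
    ⟨p.2.1, p.1, p.2.2.symm⟩
  let E := Equiv.sigmaCongrRight e
  let L : Representation n :=
    { deg := fun v => (G.neighborSet v).ncard
      mate := fun p => E.symm (flip (E p))
      mate_mate := fun p => by
        rw [E.apply_symm_apply]
        exact E.symm_apply_apply p
      mate_ne := fun p hp => by
        have h := congrArg Sigma.fst ((E.symm_apply_eq).1 hp)
        exact G.ne_of_adj (E p).2.2 h.symm }
  have hnbr : ∀ v j, L.nbr v j = e v j := fun v j => rfl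
  refine ⟨L, fun v => ⟨fun i j hij => ?_, ?_⟩, fun v => rfl, fun v j hd hj => he v j hd hj⟩
  · exact (e v).injective (Subtype.ext hij)
  · ext u
    constructor
    · rintro ⟨j, rfl⟩
      exact (e v j).2
    · intro hu
      exact ⟨(e v).symm ⟨u, hu⟩, by rw [hnbr, Equiv.apply_symm_apply]⟩

/-! ### The hard graphs -/

section HardGraph

/-- The entry of the list of `x < n₁` in the direction `+ (s + 1)`: the cyclic successor
`x + (s + 1)` modulo `n₁`, unless the edge is rerouted to the new vertex `n₁ + 2 * τ s`. -/
def succNbr (n₁ k e : ℕ) {h : ℕ} (τ : Equiv.Perm (Fin h)) (x : ℕ) (s : Fin h) : ℕ :=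
  if (τ s : ℕ) < k ∧ x < e then n₁ + 2 * τ s
  else if x + (s + 1) < n₁ then x + (s + 1) else x + (s + 1) - n₁

/-- The entry of the list of `x < n₁` in the direction `- (s + 1)`: the cyclic predecessor
`x - (s + 1)` modulo `n₁`, unless the edge is rerouted to the new vertex `n₁ + 2 * τ s + 1`. -/
def predNbr (n₁ k e : ℕ) {h : ℕ} (τ : Equiv.Perm (Fin h)) (x : ℕ) (s : Fin h) : ℕ :=
  if (τ s : ℕ) < k ∧ s + 1 ≤ x ∧ x < s + 1 + e then n₁ + 2 * τ s + 1
  else if s + 1 ≤ x then x - (s + 1) else x + n₁ - (s + 1)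

variable {n₁ k e h : ℕ} {τ : Equiv.Perm (Fin h)}

theorem succNbr_lt (hh : h + h < n₁) {x : ℕ} (hx : x < n₁) (s : Fin h) :
    succNbr n₁ k e τ x s < n₁ + (k + k) := by
  have := s.2
  unfold succNbr
  split_ifs <;> omega

theorem predNbr_lt (hh : h + h < n₁) {x : ℕ} (hx : x < n₁) (s : Fin h) :
    predNbr n₁ k e τ x s < n₁ + (k + k) := by
  have := s.2
  unfold predNbr
  split_ifs <;> omega

variable (n₁ k e τ) in
/-- The circulant graph on `[0, n₁)` with the steps `1, …, h`, together with `2 * k` new vertices.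
For each step `s + 1` with `p = τ s < k`, the `e` edges `{x, x + (s + 1)}` with `x < e` are replaced
by the edges from `x` to the new vertex `n₁ + 2 * p` and from `x + (s + 1)` to its partner
`n₁ + 2 * p + 1`. For `e = 0` the new vertices are isolated. -/
def hardGraph (hh : h + h < n₁) : SimpleGraph (Fin (n₁ + (k + k))) where
  Adj u v :=
    ((u : ℕ) < n₁ ∧ ∃ s, (v : ℕ) = succNbr n₁ k e τ u s ∨ (v : ℕ) = predNbr n₁ k e τ u s) ∨
    ((v : ℕ) < n₁ ∧ ∃ s, (u : ℕ) = succNbr n₁ k e τ v s ∨ (u : ℕ) = predNbr n₁ k e τ v s)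
  symm := ⟨fun _ _ h => h.symm⟩
  loopless := ⟨fun u hu => by
    have : ∀ s, (u : ℕ) < n₁ → (u : ℕ) ≠ succNbr n₁ k e τ u s ∧
        (u : ℕ) ≠ predNbr n₁ k e τ u s := by
      intro s hs
      have := s.2
      unfold succNbr predNbr
      constructor <;> split_ifs <;> omega
    obtain ⟨hu, s, hs⟩ | ⟨hu, s, hs⟩ := hu
    all_goals exact hs.elim (this s hu).1 (this s hu).2⟩

/-- Among the old vertices, successors and predecessors correspond. Since `e + h ≤ n₁`, an edge that
wraps around `0` is never rerouted, so the two rerouting conditions describe the same edges. -/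
theorem listed_symm (hh : h + h < n₁) (he : e + h ≤ n₁) {x y : ℕ} (hx : x < n₁) (hy : y < n₁)
    (H : ∃ s, x = succNbr n₁ k e τ y s ∨ x = predNbr n₁ k e τ y s) :
    ∃ s, y = succNbr n₁ k e τ x s ∨ y = predNbr n₁ k e τ x s := by
  obtain ⟨s, H | H⟩ := H
  · refine ⟨s, .inr ?_⟩
    have := s.2
    unfold succNbr at H
    unfold predNbr
    split_ifs at H ⊢ <;> omega
  · refine ⟨s, .inl ?_⟩
    have := s.2
    unfold predNbr at H
    unfold succNbr
    split_ifs at H ⊢ <;> omega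

theorem hardGraph_adj_old (hh : h + h < n₁) (he : e + h ≤ n₁) {u v : Fin (n₁ + (k + k))}
    (hu : (u : ℕ) < n₁) : (hardGraph n₁ k e τ hh).Adj u v ↔
      ∃ s, (v : ℕ) = succNbr n₁ k e τ u s ∨ (v : ℕ) = predNbr n₁ k e τ u s := by
  refine ⟨?_, fun H => .inl ⟨hu, H⟩⟩
  rintro (⟨-, H⟩ | ⟨hv, H⟩)
  · exact H
  · exact listed_symm hh he hu hv H

theorem ncard_neighborSet_old (hh : h + h < n₁) (he : e + h ≤ n₁) {u : Fin (n₁ + (k + k))}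
    (hu : (u : ℕ) < n₁) : ((hardGraph n₁ k e τ hh).neighborSet u).ncard = h + h := by
  let φ : Fin h ⊕ Fin h → Fin (n₁ + (k + k)) :=
    Sum.elim (fun s => ⟨succNbr n₁ k e τ u s, succNbr_lt hh hu s⟩)
      (fun s => ⟨predNbr n₁ k e τ u s, predNbr_lt hh hu s⟩)
  have hφ : Function.Injective φ := by
    have hτ : ∀ s s' : Fin h, (τ s : ℕ) = τ s' → (s : ℕ) = s' := fun s s' hs => by
      rw [τ.injective (Fin.ext hs)]
    refine Function.Injective.sumElim ?_ ?_ ?_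
    · intro s s' H
      have H := Fin.ext_iff.1 H
      have := hτ s s'
      have := s.2
      have := s'.2
      ext
      simp only [succNbr] at H
      split_ifs at H <;> omega
    · intro s s' H
      have H := Fin.ext_iff.1 H
      have := hτ s s'
      have := s.2
      have := s'.2
      ext
      simp only [predNbr] at H
      split_ifs at H <;> omega
    · intro s s' H
      have H := Fin.ext_iff.1 H
      have := s.2
      have := s'.2
      simp only [succNbr, predNbr] at H
      split_ifs at H <;> omega
  have hrange : (hardGraph n₁ k e τ hh).neighborSet u = Set.range φ := by
    ext v
    rw [SimpleGraph.mem_neighborSet, hardGraph_adj_old hh he hu]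
    constructor
    · rintro ⟨s, H | H⟩
      · exact ⟨.inl s, Fin.ext H.symm⟩
      · exact ⟨.inr s, Fin.ext H.symm⟩
    · rintro ⟨s | s, rfl⟩
      · exact ⟨s, .inl rfl⟩
      · exact ⟨s, .inr rfl⟩
  rw [hrange, ← Nat.card_coe_set_eq, Nat.card_range_of_injective hφ, Nat.card_eq_fintype_card,
    Fintype.card_sum, Fintype.card_fin]

theorem ncard_neighborSet_new (hh : h + h < n₁) (he : e + h ≤ n₁) (hk : k ≤ h)
    {u : Fin (n₁ + (k + k))} (hu : ¬ (u : ℕ) < n₁) :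
    ((hardGraph n₁ k e τ hh).neighborSet u).ncard = e := by
  -- `u` is the new vertex with number `b ∈ {0, 1}` in the pair `p`, which belongs to the step `s`.
  obtain ⟨p, b, hb, hup⟩ : ∃ p b : ℕ, b < 2 ∧ (u : ℕ) = n₁ + 2 * p + b :=
    ⟨((u : ℕ) - n₁) / 2, ((u : ℕ) - n₁) % 2, by omega, by omega⟩
  have hp : p < k := by have := u.2; omega
  obtain ⟨s, hs⟩ := τ.surjective ⟨p, by omega⟩
  have hsp : (τ s : ℕ) = p := by rw [hs]
  have hsh := s.2
  let φ : Fin e → Fin (n₁ + (k + k)) := fun x => ⟨x + b * (s + 1), by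
    have := x.2
    interval_cases b <;> omega⟩
  have hφ : Function.Injective φ := fun x y H => by
    have H := Fin.ext_iff.1 H
    simp only [φ] at H
    ext
    omega
  have hrange : (hardGraph n₁ k e τ hh).neighborSet u = Set.range φ := by
    have hτ : ∀ s' : Fin h, (τ s' : ℕ) = p → s' = s := fun s' hs' =>
      τ.injective (Fin.ext (hs'.trans hsp.symm))
    ext v
    constructor
    · rintro (⟨h', -⟩ | ⟨hv, s', H⟩)
      · exact absurd h' hu
      · have hss := hτ s'
        obtain H | H := H
        · simp only [succNbr] at H
          refine ⟨⟨v, by split_ifs at H <;> omega⟩, Fin.ext ?_⟩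
          simp only [φ]
          obtain rfl : b = 0 := by split_ifs at H <;> omega
          omega
        · simp only [predNbr] at H
          obtain rfl : b = 1 := by split_ifs at H <;> omega
          obtain rfl : s' = s := hss (by split_ifs at H <;> omega)
          refine ⟨⟨v - (s' + 1), by split_ifs at H <;> omega⟩, Fin.ext ?_⟩
          simp only [φ]
          split_ifs at H <;> omega
    · rintro ⟨x, rfl⟩
      have hx := x.2
      refine .inr ⟨by simp only [φ]; interval_cases b <;> omega, s, ?_⟩
      interval_cases b
      · left
        simp only [φ, succNbr]
        rw [if_pos (by omega)]
        omega
      · right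
        simp only [φ, predNbr]
        rw [if_pos (by omega)]
        omega
  rw [hrange, ← Nat.card_coe_set_eq, Nat.card_range_of_injective hφ, Nat.card_eq_fintype_card,
    Fintype.card_fin]

/-- An edge of the circulant graph on all `n₁ + 2 * k` vertices survives in `hardGraph` if it misses
the new vertices and is not rerouted. If it passes over the block of new vertices, then it is an
edge of the circulant graph on `[0, n₁)` with a step shorter by `2 * k`. -/
theorem hardGraph_adj_of_step (hh : h + h < n₁) (he : e + h ≤ n₁) (s : Fin h)
    {u v : Fin (n₁ + (k + k))} (hu : (u : ℕ) < n₁) (hv : (v : ℕ) < n₁)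
    (huv : (v : ℕ) = ((u : ℕ) + (s + 1)) % (n₁ + (k + k))) (hs : ¬ ((τ s : ℕ) < k ∧ (u : ℕ) < e)) :
    (hardGraph n₁ k e τ hh).Adj u v := by
  have hsh := s.2
  by_cases hw : (u : ℕ) + (s + 1) < n₁ + (k + k)
  · rw [Nat.mod_eq_of_lt hw] at huv
    refine .inl ⟨hu, s, .inl ?_⟩
    rw [succNbr, if_neg hs, if_pos (by omega), huv]
  · rw [Nat.mod_eq_sub_mod (by omega), Nat.mod_eq_of_lt (by omega)] at huv
    refine .inl ⟨hu, ⟨s - (k + k), by omega⟩, .inl ?_⟩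
    rw [succNbr, if_neg (by omega), if_neg (by simp only; omega), huv]
    simp only
    omega

end HardGraph

/-! ### Random shifts of the hard graphs -/

theorem card_filter_add {N : ℕ} [NeZero N] (a : Fin N) (P : Fin N → Prop) [DecidablePred P] :
    (Finset.univ.filter fun c => P (a + c)).card = (Finset.univ.filter P).card :=
  Finset.card_equiv (Equiv.addLeft a) (by simp)

theorem card_filter_add_right {N : ℕ} [NeZero N] (a : Fin N) (P : Fin N → Prop)
    [DecidablePred P] :
    (Finset.univ.filter fun v => P (v + a)).card = (Finset.univ.filter P).card :=
  Finset.card_equiv (Equiv.addRight a) (by simp)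

/-- The steps of the circulant graph on `Fin N`: first `1, …, h`, then `-1, …, -h`. -/
def circulantStep (N : ℕ) [NeZero N] (h : ℕ) (j : Fin (h + h)) : Fin N :=
  Fin.ofNat N (if (j : ℕ) < h then j + 1 else N - (j - h + 1))

theorem circulantStep_injective {N h : ℕ} [NeZero N] (hN : h + h < N) :
    Function.Injective (circulantStep N h) := by
  intro i j H
  have H := Fin.ext_iff.1 H
  have := i.2
  have := j.2
  simp only [circulantStep, Fin.val_ofNat] at H
  ext
  rw [Nat.mod_eq_of_lt (by split_ifs <;> omega), Nat.mod_eq_of_lt (by split_ifs <;> omega)] at H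
  split_ifs at H <;> omega

section ShiftedGraph

variable {n₁ k e h : ℕ} [NeZero n₁] [NeZero h]

variable (n₁ k e) in
/-- The hard graph with the vertices shifted cyclically by `c`, and with the pairs of new vertices
assigned to the steps by a cyclic shift by `t`. -/
def shiftedGraph (hh : h + h < n₁) (ω : Fin (n₁ + (k + k)) × Fin h) :
    SimpleGraph (Fin (n₁ + (k + k))) :=
  (hardGraph n₁ k e (Equiv.addRight ω.2) hh).comap (· + ω.1)

theorem ncard_neighborSet_shiftedGraph (hh : h + h < n₁) (he : e + h ≤ n₁) (hk : k ≤ h)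
    (ω : Fin (n₁ + (k + k)) × Fin h) (v : Fin (n₁ + (k + k))) :
    ((shiftedGraph n₁ k e hh ω).neighborSet v).ncard =
      if ((v + ω.1 : Fin (n₁ + (k + k))) : ℕ) < n₁ then h + h else e := by
  have hset : (shiftedGraph n₁ k e hh ω).neighborSet v = Equiv.addRight ω.1 ⁻¹'
      (hardGraph n₁ k e (Equiv.addRight ω.2) hh).neighborSet (v + ω.1) := rfl
  rw [hset, Set.ncard_preimage_of_injective_subset_range (Equiv.injective _)
    (by rw [Equiv.range_eq_univ]; exact Set.subset_univ _)]
  split_ifs with hv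
  · exact ncard_neighborSet_old hh he hv
  · exact ncard_neighborSet_new hh he hk hv

theorem card_old (c : Fin (n₁ + (k + k))) :
    (Finset.univ.filter fun v : Fin (n₁ + (k + k)) =>
      ((v + c : Fin (n₁ + (k + k))) : ℕ) < n₁).card = n₁ := by
  rw [card_filter_add_right c fun x => (x : ℕ) < n₁, Fin.card_filter_val_lt]
  omega

theorem shiftedGraph_mem (hh : h + h < n₁) (he : e + h ≤ n₁) (hk : k ≤ h)
    (ω : Fin (n₁ + (k + k)) × Fin h) :
    shiftedGraph n₁ k e hh ω ∈ twoDegreeGraphs n₁ (h + h) (k + k) e := by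
  refine ⟨_, card_old ω.1, fun v hv => ?_, fun v hv => ?_⟩
  · rw [ncard_neighborSet_shiftedGraph hh he hk, if_pos (Finset.mem_filter.1 hv).2]
  · rw [ncard_neighborSet_shiftedGraph hh he hk, if_neg (by simpa using hv)]

theorem sum_ncard_neighborSet (hh : h + h < n₁) (he : e + h ≤ n₁) (hk : k ≤ h)
    (ω : Fin (n₁ + (k + k)) × Fin h) :
    ∑ v, ((shiftedGraph n₁ k e hh ω).neighborSet v).ncard = n₁ * (h + h) + (k + k) * e := by
  simp only [ncard_neighborSet_shiftedGraph hh he hk]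
  have h1 := Finset.card_filter_add_card_filter_not (s := Finset.univ)
    fun v : Fin (n₁ + (k + k)) => ((v + ω.1 : Fin (n₁ + (k + k))) : ℕ) < n₁
  rw [card_old, Finset.card_univ, Fintype.card_fin] at h1
  rw [Finset.sum_ite, Finset.sum_const, Finset.sum_const, card_old, smul_eq_mul, smul_eq_mul,
    show (Finset.univ.filter fun v : Fin (n₁ + (k + k)) =>
      ¬ ((v + ω.1 : Fin (n₁ + (k + k))) : ℕ) < n₁).card = k + k by omega]

/-- Every edge of the circulant graph on all vertices is missing in few of the shifted hard graphs:
an end vertex must be one of the `2 * k` new vertices, or the step of the edge must be among the `k`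
of the `h` steps in use, and its first vertex among the first `e` vertices. -/
theorem card_not_adj_le (hh : h + h < n₁) (he : e + h ≤ n₁) (v : Fin (n₁ + (k + k)))
    (j : Fin (h + h)) :
    Nat.card {ω : Fin (n₁ + (k + k)) × Fin h |
      ¬ (((v + ω.1 : Fin (n₁ + (k + k))) : ℕ) < n₁ ∧
        (shiftedGraph n₁ k e hh ω).Adj v (v + circulantStep _ h j))} ≤ 4 * k * h + e * k := by
  classical
  set u := v + circulantStep (n₁ + (k + k)) h j with hu
  -- The edge is `{a, b}` with `b = a + (s + 1)`.
  obtain ⟨s, a, b, hab, hs⟩ : ∃ (s : Fin h) (a b : Fin (n₁ + (k + k))),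
      (a = v ∧ b = u ∨ a = u ∧ b = v) ∧ b = a + Fin.ofNat _ (s + 1) := by
    by_cases hj : (j : ℕ) < h
    · exact ⟨⟨j, hj⟩, v, u, .inl ⟨rfl, rfl⟩, by rw [hu, circulantStep, if_pos hj]⟩
    · refine ⟨⟨j - h, by omega⟩, u, v, .inr ⟨rfl, rfl⟩, ?_⟩
      rw [hu, circulantStep, if_neg hj, add_assoc]
      have : Fin.ofNat _ ((n₁ + (k + k)) - (j - h + 1)) + Fin.ofNat _ (j - h + 1) =
          (0 : Fin (n₁ + (k + k))) := by
        ext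
        rw [Fin.val_add, Fin.val_ofNat, Fin.val_ofNat, ← Nat.add_mod,
          Nat.sub_add_cancel (by omega), Nat.mod_self, Fin.val_zero]
      rw [this, add_zero]
  let W := fun w : Fin (n₁ + (k + k)) => Finset.univ.filter fun c : Fin (n₁ + (k + k)) =>
    ¬ ((w + c : Fin (n₁ + (k + k))) : ℕ) < n₁
  have hW : ∀ w, (W w).card = k + k := by
    intro w
    have h1 := Finset.card_filter_add_card_filter_not (s := Finset.univ)
      fun x : Fin (n₁ + (k + k)) => (x : ℕ) < n₁
    rw [Fin.card_filter_val_lt, Finset.card_univ, Fintype.card_fin] at h1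
    simp only [W]
    rw [card_filter_add w fun x => ¬ (x : ℕ) < n₁]
    omega
  let T := Finset.univ.filter fun c : Fin (n₁ + (k + k)) => ((a + c : Fin (n₁ + (k + k))) : ℕ) < e
  have hT : T.card ≤ e := by
    simp only [T]
    rw [card_filter_add a fun x => (x : ℕ) < e, Fin.card_filter_val_lt]
    exact min_le_right _ _
  let K := Finset.univ.filter fun t : Fin h => ((s + t : Fin h) : ℕ) < k
  have hK : K.card ≤ k := by
    simp only [K]
    rw [card_filter_add s fun x => (x : ℕ) < k, Fin.card_filter_val_lt]
    exact min_le_right _ _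
  have hsub : {ω : Fin (n₁ + (k + k)) × Fin h | ¬ (((v + ω.1 : Fin (n₁ + (k + k))) : ℕ) < n₁ ∧
      (shiftedGraph n₁ k e hh ω).Adj v u)} ⊆
      ((W a ×ˢ Finset.univ ∪ W b ×ˢ Finset.univ ∪ T ×ˢ K : Finset (Fin (n₁ + (k + k)) × Fin h)) :
        Set (Fin (n₁ + (k + k)) × Fin h)) := by
    rintro ⟨c, t⟩ hω
    by_contra hnot
    simp only [Finset.coe_union, Set.mem_union, Finset.mem_coe, Finset.mem_product, W, T, K,
      Finset.mem_filter, Finset.mem_univ, true_and, and_true, not_or, not_not] at hnot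
    obtain ⟨⟨ha, hb⟩, hat⟩ := hnot
    have hadj : (hardGraph n₁ k e (Equiv.addRight t) hh).Adj (a + c) (b + c) := by
      refine hardGraph_adj_of_step hh he s ha hb ?_ fun H => hat ⟨H.2, H.1⟩
      rw [hs, add_right_comm, Fin.val_add, Fin.val_ofNat, Nat.add_mod_mod]
    refine hω ?_
    obtain ⟨rfl, rfl⟩ | ⟨rfl, rfl⟩ := hab
    · exact ⟨ha, hadj⟩
    · exact ⟨hb, hadj.symm⟩
  calc Nat.card {ω : Fin (n₁ + (k + k)) × Fin h | ¬ (((v + ω.1 : Fin (n₁ + (k + k))) : ℕ) < n₁ ∧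
      (shiftedGraph n₁ k e hh ω).Adj v u)}
      ≤ (W a ×ˢ Finset.univ ∪ W b ×ˢ Finset.univ ∪ T ×ˢ K :
          Finset (Fin (n₁ + (k + k)) × Fin h)).card := by
        rw [Nat.card_coe_set_eq, ← Set.ncard_coe_finset]
        exact Set.ncard_le_ncard hsub
    _ ≤ (k + k) * h + (k + k) * h + e * k := by
        refine (Finset.card_union_le _ _).trans
          (add_le_add ((Finset.card_union_le _ _).trans ?_) ?_)
        · rw [Finset.card_product, Finset.card_product, hW, hW, Finset.card_univ, Fintype.card_fin]
        · rw [Finset.card_product]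
          exact Nat.mul_le_mul hT hK
    _ = 4 * k * h + e * k := by ring

theorem exists_shifted_representations (hh : h + h < n₁) (he : e + h ≤ n₁) (hk : k ≤ h) :
    ∃ L : Fin (n₁ + (k + k)) × Fin h → Representation (n₁ + (k + k)),
      (∀ ω, ∃ G ∈ twoDegreeGraphs n₁ (h + h) (k + k) e, (L ω).Represents G) ∧
      (∀ ω, Fintype.card (L ω).Port = n₁ * (h + h) + (k + k) * e) ∧
      ∀ v j, (PMF.uniformOfFintype (Fin (n₁ + (k + k)) × Fin h)).toOuterMeasure
        {ω | ¬ (L ω).Agrees (fun v j => v + circulantStep (n₁ + (k + k)) h j) v j} ≤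
          ((4 * k * h + e * k : ℕ) : ℝ≥0∞) / ((n₁ + (k + k)) * h : ℕ) := by
  classical
  choose L hL hdeg hagree using fun ω => exists_represents_agreeing (shiftedGraph n₁ k e hh ω)
    (fun v j => v + circulantStep (n₁ + (k + k)) h j)
    (fun v => (add_right_injective v).comp (circulantStep_injective (by omega)))
  refine ⟨L, fun ω => ⟨_, shiftedGraph_mem hh he hk ω, hL ω⟩, fun ω => ?_, fun v j => ?_⟩
  · rw [Fintype.card_sigma, ← sum_ncard_neighborSet hh he hk ω]
    exact Finset.sum_congr rfl fun v _ => by rw [Fintype.card_fin, hdeg]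
  · rw [PMF.toOuterMeasure_uniformOfFintype_apply, Fintype.card_prod, Fintype.card_fin,
      Fintype.card_fin]
    refine ENNReal.div_le_div_right (Nat.cast_le.2 ?_) _
    rw [← Nat.card_eq_fintype_card]
    refine le_trans ?_ (card_not_adj_le (k := k) hh he v j)
    rw [Nat.card_coe_set_eq, Nat.card_coe_set_eq]
    refine Set.ncard_le_ncard fun ω hω H => hω ?_
    have hd : (L ω).deg v = h + h := by
      rw [hdeg, ncard_neighborSet_shiftedGraph hh he hk, if_pos H.1]
    exact ⟨hd, hagree ω v j hd H.2⟩

end ShiftedGraph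

/-! ### The lower bound -/

theorem eq_of_mem_reps {n₁ d₁ n₂ d₂ : ℕ} (hd₁ : 0 < d₁) (hn₂ : 0 < n₂) (hd₂ : 0 < d₂)
    {L : Representation (n₁ + n₂)} {F F' : Family} (hF : L ∈ F.reps n₁ d₁ n₂ d₂)
    (hF' : L ∈ F'.reps n₁ d₁ n₂ d₂) : F' = F := by
  -- Only the graphs of the first family have an isolated vertex.
  have key : L ∈ Family.first.reps n₁ d₁ n₂ d₂ → L ∈ Family.second.reps n₁ d₁ n₂ d₂ → False := by
    rintro ⟨G, ⟨S, hS, -, hG⟩, hLG⟩ ⟨G', ⟨S', -, hG', hG''⟩, hLG'⟩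
    obtain ⟨v, hv⟩ : ∃ v, v ∉ S := by
      by_contra! H
      have : S.card = n₁ + n₂ := by
        rw [Finset.eq_univ_iff_forall.2 H, Finset.card_univ, Fintype.card_fin]
      omega
    have h0 := hG v hv
    rw [← (hLG v).2, (hLG' v).2] at h0
    by_cases hv' : v ∈ S'
    · have := hG' v hv'
      omega
    · have := hG'' v hv'
      omega
  cases F <;> cases F'
  · rfl
  · exact (key hF hF').elim
  · exact (key hF' hF).elim
  · rfl

/-- A distribution on which `q` queries are correct with probability at most `1 / 2 + q * ε`. The
first term of `ε` is the probability that a given port is affected, the second accounts for the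
additional edges of the graphs of the second family in a random edge query. With `d₁ = 2 * h` and
`n₂ = 2 * k` the sum is at most `2 * r`. -/
theorem exists_hard_distribution {n₁ k h d₂ : ℕ} (hh₀ : 0 < h) (hk₀ : 0 < k) (hd₂ : 0 < d₂)
    (hk : k ≤ h) (hlt : h + h + 2 * d₂ < n₁) :
    ∃ D : PMF (Representation (n₁ + (k + k))),
      D.support ⊆ Family.first.reps n₁ (h + h) (k + k) d₂ ∪
        Family.second.reps n₁ (h + h) (k + k) d₂ ∧
      ∀ (q : ℕ) (A : Algorithm (n₁ + (k + k))), (∀ L ∈ D.support, A.MakesAtMost L q) →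
        successProb (h + h) d₂ D A ≤ 2⁻¹ +
          q * (((4 * k * h + d₂ * k : ℕ) : ℝ≥0∞) / ((n₁ + (k + k)) * h : ℕ) +
            ((k + k) * d₂ : ℕ) / ((n₁ + (k + k)) * (h + h) : ℕ)) := by
  classical
  have : NeZero n₁ := ⟨by omega⟩
  have : NeZero h := ⟨by omega⟩
  have : NeZero (h + h) := ⟨by omega⟩
  set N := n₁ + (k + k) with hN
  set ε : ℝ≥0∞ := ((4 * k * h + d₂ * k : ℕ) : ℝ≥0∞) / (N * h : ℕ) +
    ((k + k) * d₂ : ℕ) / (N * (h + h) : ℕ) with hε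
  let Ω := Fin N × Fin h
  let μ : PMF Ω := PMF.uniformOfFintype Ω
  let f : Fin N → Fin (h + h) → Fin N := fun v j => v + circulantStep N h j
  -- Both families come from the same construction, with `e = 0` and with `e = d₂`.
  have hex : ∀ F : Family, ∃ L : Ω → Representation N,
      (∀ ω, L ω ∈ F.reps n₁ (h + h) (k + k) d₂) ∧
      ∀ (A : Algorithm N) (q : ℕ), ∑' ω, μ ω * (A.truncate q).run (L ω) F ≤
        (A.truncate q).runWith (referenceOracle f) F + q * ε := by
    intro F
    obtain ⟨e, he, hF⟩ : ∃ e ≤ d₂,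
        F.graphs n₁ (h + h) (k + k) d₂ = twoDegreeGraphs n₁ (h + h) (k + k) e := by
      cases F
      · exact ⟨0, d₂.zero_le, rfl⟩
      · exact ⟨d₂, le_rfl, rfl⟩
    obtain ⟨L, hL, hport, hdist⟩ :=
      exists_shifted_representations (n₁ := n₁) (k := k) (e := e) (h := h)
        (by omega) (by omega) hk
    refine ⟨L, fun ω => ?_, fun A q => ?_⟩
    · rw [Family.reps, Set.mem_ofPred_eq, hF]
      exact hL ω
    · refine expected_run_le μ f ((k + k) * d₂) L _ (fun ω => ?_) (fun ω => ?_)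
        (fun v j => ?_) F A q
      · rw [← Fintype.card_pos_iff, hport]
        have : 0 < n₁ * (h + h) := Nat.mul_pos (by omega) (by omega)
        omega
      · rw [hport]
        exact add_le_add (Nat.mul_le_mul_right _ (by omega)) (Nat.mul_le_mul_left _ he)
      · refine (hdist v j).trans (ENNReal.div_le_div_right (Nat.cast_le.2 ?_) _)
        exact Nat.add_le_add_left (Nat.mul_le_mul_right _ he) _
  choose L hmem hrun using hex
  let fam : Bool → Family := fun b => bif b then .first else .second
  let D : PMF (Representation N) :=
    (PMF.uniformOfFintype Bool).bind fun b => μ.map (L (fam b))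
  have hsupp : ∀ b ω, L (fam b) ω ∈ D.support := by
    intro b ω
    rw [PMF.mem_support_bind_iff]
    refine ⟨b, PMF.mem_support_uniformOfFintype b, ?_⟩
    rw [PMF.mem_support_map_iff]
    exact ⟨ω, PMF.mem_support_uniformOfFintype ω, rfl⟩
  refine ⟨D, ?_, fun q A hA => ?_⟩
  · intro x hx
    obtain ⟨b, -, hx⟩ := (PMF.mem_support_bind_iff _ _ _).1 hx
    obtain ⟨ω, -, rfl⟩ := (PMF.mem_support_map_iff _ _ _).1 hx
    cases b
    · exact .inr (hmem _ ω)
    · exact .inl (hmem _ ω)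
  · have hsucc : ∀ b ω, ((A.run (L (fam b) ω)).map fun F => (L (fam b) ω, F)).toOuterMeasure
        {x | x.1 ∈ x.2.reps n₁ (h + h) (k + k) d₂} =
          (A.truncate q).run (L (fam b) ω) (fam b) := by
      intro b ω
      rw [Algorithm.run_truncate (hA _ (hsupp b ω)), PMF.toOuterMeasure_map_apply,
        ← PMF.toOuterMeasure_apply_singleton]
      congr 1
      ext F
      constructor
      · exact fun hF => eq_of_mem_reps (by omega) (by omega) hd₂ (hmem _ ω) hF
      · rintro rfl
        exact hmem _ ω
    have hval : successProb (h + h) d₂ D A =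
        ∑ b, 2⁻¹ * ∑' ω, μ ω * (A.truncate q).run (L (fam b) ω) (fam b) := by
      simp only [successProb, D, PMF.bind_bind, PMF.bind_map, Function.comp_def,
        PMF.toOuterMeasure_bind_apply, tsum_fintype (L := .unconditional Bool),
        PMF.uniformOfFintype_apply, Fintype.card_bool, Nat.cast_ofNat]
      exact Finset.sum_congr rfl fun b _ => congrArg _ (tsum_congr fun ω => congrArg _ (hsucc b ω))
    rw [hval, Fintype.sum_bool, ← mul_add]
    set P := (A.truncate q).runWith (referenceOracle f)
    have hP : P .first + P .second ≤ 1 := by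
      rw [← P.tsum_coe]
      have := ENNReal.sum_le_tsum (f := P) {Family.first, Family.second}
      rwa [Finset.sum_pair (by simp)] at this
    calc _ ≤ (2⁻¹ : ℝ≥0∞) * ((P .first + q * ε) + (P .second + q * ε)) := by
          gcongr
          · exact hrun .first A q
          · exact hrun .second A q
      _ = 2⁻¹ * (P .first + P .second) + (2⁻¹ * 2) * (q * ε) := by ring
      _ ≤ 2⁻¹ * 1 + (2⁻¹ * 2) * (q * ε) := by gcongr
      _ = 2⁻¹ + q * ε := by
          rw [ENNReal.inv_mul_cancel (by norm_num) (by norm_num), mul_one, one_mul]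

end StarLower

end

theorem mainTheorem6 {ι : Type*} (l : Filter ι) (n₁ d₁ n₂ d₂ q : ι → ℕ) (r : ι → ℝ)
    (hn₁ : ∀ k, 0 < n₁ k) (hd₁ : ∀ k, 0 < d₁ k) (hn₂ : ∀ k, 0 < n₂ k) (hd₂ : ∀ k, 0 < d₂ k)
    (hd₁_even : ∀ k, Even (d₁ k)) (hn₂_even : ∀ k, Even (n₂ k))
    (hn₂_le : ∀ k, n₂ k ≤ d₁ k) (hd₁_le : ∀ k, d₁ k ≤ 2 * d₂ k)
    (hlt : ∀ k, d₁ k + 2 * d₂ k < n₁ k)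
    (hr : ∀ k, r k = (((d₁ k : ℝ) + (d₂ k : ℝ)) * (n₂ k : ℝ)) / ((d₁ k : ℝ) * (n₁ k : ℝ)))
    (hq : (fun k => (q k : ℝ)) =o[l] fun k => 1 / r k) :
    ∃ D : (k : ι) → PMF (StarLower.Representation (n₁ k + n₂ k)),
      (∀ k, (D k).support ⊆
        StarLower.Family.first.reps (n₁ k) (d₁ k) (n₂ k) (d₂ k) ∪
          StarLower.Family.second.reps (n₁ k) (d₁ k) (n₂ k) (d₂ k)) ∧
      ∀ᶠ k in l, ∀ A : StarLower.Algorithm (n₁ k + n₂ k),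
        (∀ L ∈ (D k).support, A.MakesAtMost L (q k)) →
          StarLower.successProb (d₁ k) (d₂ k) (D k) A < 2 / 3 := by
  have key : ∀ i, ∃ D : PMF (StarLower.Representation (n₁ i + n₂ i)),
      D.support ⊆ StarLower.Family.first.reps (n₁ i) (d₁ i) (n₂ i) (d₂ i) ∪
        StarLower.Family.second.reps (n₁ i) (d₁ i) (n₂ i) (d₂ i) ∧
      ∀ (q : ℕ) (A : StarLower.Algorithm (n₁ i + n₂ i)),
        (∀ L ∈ D.support, A.MakesAtMost L q) →
          StarLower.successProb (d₁ i) (d₂ i) D A ≤ ENNReal.ofReal (1 / 2 + q * (2 * r i)) := by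
    intro i
    rw [hr i]
    have h1 := hn₁ i
    have h2 := hd₁ i
    have h3 := hn₂ i
    have h4 := hd₂ i
    have h5 := hn₂_le i
    have h6 := hlt i
    obtain ⟨h, hh⟩ := hd₁_even i
    obtain ⟨k, hk⟩ := hn₂_even i
    generalize n₁ i = n₁ at *
    generalize d₁ i = d₁ at *
    generalize n₂ i = n₂ at *
    generalize d₂ i = d₂ at *
    subst hh hk
    obtain ⟨D, hD, hDA⟩ := StarLower.exists_hard_distribution (n₁ := n₁) (k := k) (h := h)
      (d₂ := d₂) (by omega) (by omega) h4 (by omega) h6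
    refine ⟨D, hD, fun q A hA => (hDA q A hA).trans ?_⟩
    have hh0 : (0 : ℝ) < h := by exact_mod_cast (by omega : 0 < h)
    have hn0 : (0 : ℝ) < n₁ := by exact_mod_cast h1
    have hk0 : (0 : ℝ) ≤ k := k.cast_nonneg
    have hd0 : (0 : ℝ) ≤ d₂ := d₂.cast_nonneg
    have cast_div : ∀ a b : ℕ, 0 < b → (a : ENNReal) / b = ENNReal.ofReal ((a : ℝ) / b) := by
      intro a b hb
      rw [ENNReal.ofReal_div_of_pos (by exact_mod_cast hb), ENNReal.ofReal_natCast,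
        ENNReal.ofReal_natCast]
    rw [cast_div _ _ (Nat.mul_pos (by omega) (by omega)),
      cast_div _ _ (Nat.mul_pos (by omega) (by omega)), ← ENNReal.ofReal_add (by positivity)
      (by positivity), ← ENNReal.ofReal_natCast q, ← ENNReal.ofReal_mul (by positivity),
      show (2⁻¹ : ENNReal) = ENNReal.ofReal (1 / 2) by
        rw [one_div, ENNReal.ofReal_inv_of_pos two_pos, ENNReal.ofReal_ofNat],
      ← ENNReal.ofReal_add (by positivity) (by positivity)]
    refine ENNReal.ofReal_le_ofReal ?_
    gcongr
    push_cast
    calc (4 * (k : ℝ) * h + d₂ * k) / ((n₁ + (k + k)) * h) +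
          (k + k) * d₂ / ((n₁ + (k + k)) * (h + h))
        ≤ (4 * (k : ℝ) * h + d₂ * k) / (n₁ * h) + (k + k) * d₂ / (n₁ * (h + h)) := by
          gcongr <;> linarith
      _ = 2 * (((h : ℝ) + h + d₂) * (k + k) / ((h + h) * n₁)) := by
          field_simp
          ring
  choose D hD hDA using key
  refine ⟨D, hD, ?_⟩
  -- The error `2 * r * q` is then at most `2 / 13`, less than `2 / 3 - 1 / 2`.
  filter_upwards [hq.bound (show (0 : ℝ) < 1 / 13 by norm_num)] with i hi A hA
  refine (hDA i (q i) A hA).trans_lt ?_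
  have hr0 : 0 < r i := by
    have := hn₁ i
    have := hd₁ i
    have := hn₂ i
    have := hd₂ i
    rw [hr i]
    positivity
  rw [Real.norm_of_nonneg (by positivity), Real.norm_of_nonneg (by positivity)] at hi
  have hqr : (q i : ℝ) * r i ≤ 1 / 13 := by
    calc (q i : ℝ) * r i ≤ 1 / 13 * (1 / r i) * r i := by gcongr
      _ = 1 / 13 := by field_simp
  rw [show (2 / 3 : ENNReal) = ENNReal.ofReal (2 / 3) by
    rw [ENNReal.ofReal_div_of_pos (by norm_num), ENNReal.ofReal_ofNat, ENNReal.ofReal_ofNat]]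
  exact (ENNReal.ofReal_lt_ofReal_iff (by norm_num)).2 (by linarith)
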